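/- **Proposition (quantum Lichnerowicz formula).** *Set-up.* Let $\mathcal A$ be the Hopf $*$-algebra of polynomial functions on a compact matrix quantum group $G$, with coproduct $\phi$, counit $\epsilon$ and antipode $\kappa$; write $\phi^{(2)}(a)=a^{(1)}\otimes a^{(2)}\otimes a^{(3)}$. Let $P=(\mathcal B,i,F)$ be a quantum principal $G$-bundle: $\mathcal B$ is a unital $*$-algebra, $F:\mathcal B\to\mathcal B\otimes\mathcal A$ a $*$-homomorphism and a right coaction that is free (the elements $qF(b)$ span $\mathcal B\otimes\mathcal A$), and $\mathcal V=\{b: F(b)=b\otimes 1\}$ is the algebra of the base $M$. Write $F(b)=\sum_k b_k\otimes c_k$. *Forms.* Let $\mathbb V$ be a complex vector space with basis $\theta_1,\dots,\theta_d$, a right coaction $\varkappa$ of $\mathcal A$, a right $\mathcal A$-module structure $\circ$ and an antilinear involution $*$, such that $\varkappa(\theta\circ a)=\sum_k(\vartheta_k\circ a^{(2)})\otimes\kappa(a^{(1)})c_ka^{(3)}$ if $\varkappa(\theta)=\sum_k\vartheta_k\otimes c_k$, $\varkappa *=(*\otimes *)\varkappa$ and $(\theta\circ a)^*=\theta^*\circ\kappa(a)^*$.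 Let $\tau(\eta\otimes\vartheta)=\sum_k\vartheta_k\otimes(\eta\circ c_k)$, where $\varkappa(\vartheta)=\sum_k\vartheta_k\otimes c_k$, be the canonical braid operator, and let $\mathbb V^\wedge=\mathbb V^\otimes/\langle\mathrm{im}(I+\tau)\rangle$ be the $\tau$-exterior algebra, with the induced $\circ$ and $\varkappa$. The horizontal forms are the algebra $\mathfrak{hor}_P=\mathcal B\otimes\mathbb V^\wedge$ with product $(q\otimes\vartheta)(b\otimes\eta)=\sum_k qb_k\otimes(\vartheta\circ c_k)\eta$ and with the product coaction $F^\wedge$. Let $\nabla:\mathfrak{hor}_P\to\mathfrak{hor}_P$ be the Levi-Civita connection of a frame structure: a hermitian, $F^\wedge$-covariant, degree-one antiderivation which vanishes on $\mathbb V$ and on $\nabla(\mathcal V)$ and is complete: there are $f_\alpha\in\mathcal V$ and linear $b_\alpha:\mathbb V\to\mathcal B$, finitely many, with $1\otimes\theta=\sum_\alpha b_\alpha(\theta)\nabla(f_\alpha)$ and $F(b_\alpha(\theta))=(b_\alpha\otimes\mathrm{id})\varkappa(\theta)$. The coordinate vector fields $\partial_i:\mathcal B\to\mathcal B$ are given by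 $\nabla(b)=\sum_i\partial_i(b)\otimes\theta_i$. A curvature of $\nabla$ is a linear map $\varrho:\mathcal A\to\mathfrak{hor}_P$ with $\nabla^2(b)=-\sum_k b_k\varrho(c_k)$ for all $b\in\mathcal B$. *Clifford algebra.* Let $\sigma$ be an invertible braid operator on $\mathbb V\otimes\mathbb V$ commuting with the involution $(x\otimes y)^*=y^*\otimes x^*$ and coupled to $\tau$: $\mathbb V^\wedge=\mathbb V^\otimes/\ker A_\sigma$, where $A_\sigma$ is the total braided antisymmetrizer. Let $\Sigma$ be a unital $*$-algebra and $g:\mathbb V\otimes\mathbb V\to\Sigma$ a quantum metric: with $g_{ij}=g(\theta_i,\theta_j)$, $g\sigma=g$, $g(x,y)^*=g(y^*,x^*)$, $g\otimes g=(g\otimes g)(\mathrm{id}\otimes\sigma\otimes\mathrm{id})(\sigma^{\mp1}\otimes\sigma^{\pm1})(\mathrm{id}\otimes\sigma^{-1}\otimes\mathrm{id})$ (both choices of signs), the matrix $(g_{ij})$ is invertible, $\Sigma$ is generated by the entries of it and of its inverse, $\Sigma$ carries a multiplicative $*$-map $\varkappa:\Sigma\to\Sigma\otimes\mathcal A$ with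 $\varkappa g=(g\otimes\mathrm{id})\varkappa$, and $\mathbb V_\Sigma=\Sigma\otimes\mathbb V$ is a $\Sigma$-bimodule whose right structure satisfies $x\,g(y,z)=(g\otimes\mathrm{id})(\mathrm{id}\otimes\sigma)(\sigma^{-1}\otimes\mathrm{id})(x\otimes y\otimes z)$. Extend $g$ to tensors by $g(\psi\otimes x,y\otimes\xi)=g(\psi,g(x,y)\xi)$ (zero in different degrees), put $g_\wedge(\psi,\xi)=g(\psi,A_\sigma\xi)$, and let $\phi$ be the coproduct of $\mathbb V^\otimes$ that is multiplicative with respect to the braiding $-\sigma$ and satisfies $\phi(x)=x\otimes1+1\otimes x$ for $x\in\mathbb V$. The braided Clifford algebra $\mathrm{cl}[\mathbb V,g,\sigma,\Sigma]$ is the space $\mathbb V_\Sigma^\wedge=\Sigma\otimes\mathbb V^\wedge$ with the product $\tilde m=m(\mathrm{id}\otimes g_\wedge\otimes\mathrm{id})(\phi\otimes\phi)$. *Spinors.* Let $\mathbb S$ be a quantum spinor space: a finite-dimensional nonzero Hilbert space with a unitary representation $\varkappa_{\mathbb S}$ of $G$ and an irreducible left $*$-module structure $Z\otimes\xi\mapsto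 Z[\xi]$ over $\mathrm{cl}[\mathbb V,g,\sigma,\Sigma]$ with $\varkappa_{\mathbb S}(Z[\xi])=\varkappa(Z)[\varkappa_{\mathbb S}(\xi)]$. Let $\mathcal S=\mathcal B\otimes\mathbb S$ with the product coaction $F_{\mathcal S}$, and let the quantum spinor bundle $\mathcal S_M\subseteq\mathcal S$ be the space of $F_{\mathcal S}$-invariant elements. On $\mathcal S$ put $$\mathbb D=-i\sum_j\partial_j\otimes\theta_j,\qquad \Delta_{\mathcal S}=-\sum_{ij}\partial_i\partial_j\otimes g_{ij},\qquad \widehat R(b\otimes\xi)=-\nabla^2(b)[\xi],$$ where $\theta_j,g_{ij}$ and all elements of $\mathbb V^\wedge\subseteq\mathbb V_\Sigma^\wedge$ act on $\mathbb S$ through the identification $\mathbb V_\Sigma^\wedge\leftrightarrow\mathrm{cl}[\mathbb V,g,\sigma,\Sigma]$, with $(q\otimes\vartheta)[\xi]=q\otimes\vartheta[\xi]$ for $q\otimes\vartheta\in\mathfrak{hor}_P$. *Claim.* The operators $\mathbb D$, $\Delta_{\mathcal S}$, $\widehat R$ map $\mathcal S_M$ into itself, and on $\mathcal S_M$ $$\mathbb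 D^2=\Delta_{\mathcal S}+\widehat R .$$ Moreover $\widehat R$ is the cliffordization of the curvature: if $\varrho$ is the curvature of $\nabla$, then $\widehat R(b\otimes\xi)=\sum_k\bigl(b_k\varrho(c_k)\bigr)[\xi]$ for all $b\in\mathcal B$, $\xi\in\mathbb S$. -/

import Mathlib

open scoped TensorProduct

noncomputable section

namespace QuantumSpin

/-! ### The tensor algebra -/

/-- The tensor algebra `V^⊗` of the `d`-dimensional complex vector space `V` with the fixed basis
`θ 0, …, θ (d-1)`, realized as the free algebra on the basis. -/
abbrev Tens (d : ℕ) : Type := FreeAlgebra ℂ (Fin d)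

/-- The basis vectors of `V`, in the tensor algebra. -/
def θ {d : ℕ} (i : Fin d) : Tens d := FreeAlgebra.ι ℂ i

/-- The elementary tensor `θ_{i₁} ⊗ ⋯ ⊗ θ_{iₙ}`. -/
def word {d : ℕ} (w : List (Fin d)) : Tens d := (w.map θ).prod

/-- The linear map on `V^⊗` with prescribed values on the elementary tensors of basis vectors. -/
def ofWords {d : ℕ} {M : Type*} [AddCommGroup M] [Module ℂ M] (f : List (Fin d) → M) :
    Tens d →ₗ[ℂ] M :=
  (FreeAlgebra.basisFreeMonoid ℂ (Fin d)).constr ℂ fun w => f w.toList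

theorem ofWords_word {d : ℕ} {M : Type*} [AddCommGroup M] [Module ℂ M] (f : List (Fin d) → M)
    (w : List (Fin d)) : ofWords f (word w) = f w := by
  have h : word w = FreeAlgebra.basisFreeMonoid ℂ (Fin d) (FreeMonoid.ofList w) := by
    induction w with
    | nil => simp [word, FreeAlgebra.basisFreeMonoid, ← MonoidAlgebra.one_def]
    | cons i w ih =>
      have h2 : word (i :: w) = θ i * word w := by simp [word]
      rw [h2, ih]
      simp [FreeAlgebra.basisFreeMonoid, FreeAlgebra.equivMonoidAlgebraFreeMonoid, θ]
  rw [h, ofWords, Module.Basis.constr_basis]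
  rfl

/-! ### Compact matrix quantum groups -/

/-- The Hopf `*`-algebra of polynomial functions on a compact matrix quantum group. -/
structure IsCompactMatrixQuantumGroup (A : Type*) [Ring A] [HopfAlgebra ℂ A] [StarRing A]
    [StarModule ℂ A] : Prop where
  comul_star : ∀ a : A, Coalgebra.comul (R := ℂ) (star a) = star (Coalgebra.comul (R := ℂ) a)
  counit_star : ∀ a : A, Coalgebra.counit (R := ℂ) (star a) = star (Coalgebra.counit (R := ℂ) a)
  generated : ∃ (n : ℕ) (u : Matrix (Fin n) (Fin n) A),
    (∀ i j, Coalgebra.comul (R := ℂ) (u i j) = ∑ k, u i k ⊗ₜ[ℂ] u k j) ∧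
    (∀ i j, Coalgebra.counit (R := ℂ) (u i j) = if i = j then 1 else 0) ∧
    u ∈ unitary (Matrix (Fin n) (Fin n) A) ∧
    StarAlgebra.adjoin ℂ {a : A | ∃ i j, a = u i j} = ⊤

section Coordinates

variable {A : Type*} [Ring A] [HopfAlgebra ℂ A]

/-- `a ↦ ∑ a⁽¹⁾ f(a⁽²⁾)`. -/
def sliceRight (f : A →ₗ[ℂ] ℂ) : A →ₗ[ℂ] A :=
  (TensorProduct.rid ℂ A).toLinearMap ∘ₗ f.lTensor A ∘ₗ Coalgebra.comul

/-- `a ↦ ∑ f(a⁽¹⁾) a⁽²⁾`. -/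
def sliceLeft (f : A →ₗ[ℂ] ℂ) : A →ₗ[ℂ] A :=
  (TensorProduct.lid ℂ A).toLinearMap ∘ₗ f.rTensor A ∘ₗ Coalgebra.comul

/-- The entry `ν i j` of a matrix representation. -/
def entry {n R : Type*} [Fintype n] [DecidableEq n] [Ring R] [Algebra ℂ R] {C : Type*} [Ring C]
    [Algebra ℂ C] (ν : C →ₐ[ℂ] Matrix n n R) (i j : n) : C →ₗ[ℂ] R :=
  LinearMap.proj j ∘ₗ LinearMap.proj i ∘ₗ ν.toLinearMap

theorem map_sum_apply {ι M N M' N' : Type*} [AddCommGroup M] [Module ℂ M] [AddCommGroup N]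
    [Module ℂ N] [AddCommGroup M'] [Module ℂ M'] [AddCommGroup N'] [Module ℂ N']
    (f : M →ₗ[ℂ] M') (s : Finset ι) (g : ι → N →ₗ[ℂ] N') (t : M ⊗[ℂ] N) :
    TensorProduct.map f (∑ k ∈ s, g k) t = ∑ k ∈ s, TensorProduct.map f (g k) t := by
  simp only [← TensorProduct.mapBilinear_apply, map_sum, LinearMap.sum_apply]

@[simp] theorem entry_apply {n R : Type*} [Fintype n] [DecidableEq n] [Ring R] [Algebra ℂ R]
    {C : Type*} [Ring C] [Algebra ℂ C] (ν : C →ₐ[ℂ] Matrix n n R) (i j : n) (c : C) :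
    entry ν i j c = ν c i j := rfl

end Coordinates

variable {A : Type*} [Ring A] [HopfAlgebra ℂ A] [StarRing A] [StarModule ℂ A]
variable {d : ℕ}

/-- The space `V` with a fixed basis `θ_i`, with a coaction `ϰ` of `A`, a right `A`-module structure
`∘` and an antilinear involution `*`, and the compatibility conditions among them. -/
structure AbstractForms (A : Type*) [Ring A] [HopfAlgebra ℂ A] [StarRing A] [StarModule ℂ A]
    (d : ℕ) where
  /-- The matrix of the coaction: `ϰ(θ_i) = ∑_j θ_j ⊗ ϰ_{ji}`. -/
  ϰ : Matrix (Fin d) (Fin d) A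
  /-- The right module structure: `θ_i ∘ a = ∑_j ν_{ij}(a) θ_j`. -/
  ν : A →ₐ[ℂ] Matrix (Fin d) (Fin d) ℂ
  /-- The matrix of the involution: `θ_i^* = ∑_j J_{ij} θ_j`. -/
  J : Matrix (Fin d) (Fin d) ℂ
  comul_ϰ : ∀ i j, Coalgebra.comul (R := ℂ) (ϰ i j) = ∑ k, ϰ i k ⊗ₜ[ℂ] ϰ k j
  counit_ϰ : ∀ i j, Coalgebra.counit (R := ℂ) (ϰ i j) = if i = j then 1 else 0
  /-- `ϰ(θ ∘ a) = ∑_k (θ_k ∘ a⁽²⁾) ⊗ κ(a⁽¹⁾) c_k a⁽³⁾` where `ϰ(θ) = ∑_k θ_k ⊗ c_k`, read off on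
  `θ = θ_i` as the coefficients of `θ_l`. -/
  ϰ_circ : ∀ i l a, ∑ m, ν a i m • ϰ l m =
    ∑ k, LinearMap.mul' ℂ A (TensorProduct.map (HopfAlgebra.antipode ℂ)
      (LinearMap.mulLeft ℂ (ϰ k i) ∘ₗ sliceLeft (entry ν k l)) (Coalgebra.comul (R := ℂ) a))
  /-- `*` is involutive. -/
  star_star : J.map star * J = 1
  /-- `ϰ * = (* ⊗ *) ϰ`. -/
  ϰ_star : ∀ i k, ∑ j, J i j • ϰ k j = ∑ j, J j k • star (ϰ j i)
  /-- `(θ ∘ a)^* = θ^* ∘ κ(a)^*`. -/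
  circ_star : ∀ a, (ν a).map star * J = J * ν (star (HopfAlgebra.antipode ℂ a))

namespace AbstractForms

variable (X : AbstractForms A d)

/-- The canonical braid operator `τ(η ⊗ ϑ) = ∑_k ϑ_k ⊗ (η ∘ c_k)`, in coordinates
`τ(θ_i ⊗ θ_j) = ∑_{kl} τ k l i j θ_k ⊗ θ_l`. -/
def τ (k l i j : Fin d) : ℂ := X.ν (X.ϰ k j) i l

/-- The quadratic relations `im(I + τ)`. -/
inductive ExtRel : Tens d → Tens d → Prop
  | mk (i j : Fin d) : ExtRel (θ i * θ j + ∑ k, ∑ l, X.τ k l i j • (θ k * θ l)) 0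

/-- The `τ`-exterior algebra `V^∧`. -/
abbrev Ext : Type := RingQuot X.ExtRel

/-- The projection `V^⊗ → V^∧`. -/
def toExt : Tens d →ₐ[ℂ] X.Ext := RingQuot.mkAlgHom ℂ X.ExtRel

/-- The basis vectors of `V` in `V^∧`. -/
def e (i : Fin d) : X.Ext := X.toExt (θ i)

theorem ext_rel (i j : Fin d) :
    X.e i * X.e j + ∑ k, ∑ l, X.τ k l i j • (X.e k * X.e l) = 0 := by
  simpa [e, toExt] using! RingQuot.mkAlgHom_rel ℂ (ExtRel.mk (X := X) i j)

/-- The Yetter–Drinfeld compatibility in the antipode-free form. -/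
theorem yd (i l : Fin d) (a : A) :
    ∑ m, sliceRight (entry X.ν i m) a * X.ϰ l m =
      ∑ k, X.ϰ k i * sliceLeft (entry X.ν k l) a := by
  open WithConv in
  let f : A →ₗ[ℂ] A := ∑ m, (entry X.ν i m).smulRight (X.ϰ l m)
  let g : A →ₗ[ℂ] A := ∑ k, LinearMap.mulLeft ℂ (X.ϰ k i) ∘ₗ sliceLeft (entry X.ν k l)
  have h : toConv f = toConv (HopfAlgebra.antipode ℂ) * toConv g := by
    ext a
    change f a = LinearMap.mul' ℂ A (TensorProduct.map _ g _)
    simp only [f, g, LinearMap.sum_apply, LinearMap.smulRight_apply, entry_apply, X.ϰ_circ i l a,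
      map_sum_apply, map_sum]
  have h2 : toConv LinearMap.id * toConv f = toConv g := by
    rw [h, ← mul_assoc, LinearMap.id_mul_antipode, one_mul]
  have h3 := congrArg (fun x => x.ofConv a) h2
  change LinearMap.mul' ℂ A (TensorProduct.map _ f _) = g a at h3
  simp only [f, g, LinearMap.sum_apply, map_sum_apply, map_sum,
    LinearMap.comp_apply, LinearMap.mulLeft_apply] at h3
  rw [← h3]
  refine Finset.sum_congr rfl fun m _ => ?_
  simp only [sliceRight, LinearMap.comp_apply]
  generalize Coalgebra.comul (R := ℂ) a = t
  induction t with
  | zero => simp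
  | add x y hx hy => simp only [map_add, add_mul, hx, hy]
  | tmul x y => simp

theorem τ_circ (i j m n : Fin d) (a : A) :
    ∑ l, ∑ p, X.τ m n p l * entry X.ν i p (sliceRight (entry X.ν j l) a) =
    ∑ k, ∑ p, X.τ k p i j * entry X.ν p n (sliceLeft (entry X.ν k m) a) := by
  have h := congrArg (fun x => X.ν x i n) (X.yd j m a)
  simp [Matrix.mul_apply, Matrix.sum_apply] at h
  simpa [τ, mul_comm] using h

/-- The coordinate functionals on the degree one part of `V^∧`, as an algebra map to the
trivial square-zero extension. -/
def degOne : X.Ext →ₐ[ℂ] TrivSqZeroExt ℂ (Fin d → ℂ) :=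
  RingQuot.liftAlgHom ℂ ⟨FreeAlgebra.lift ℂ fun i => TrivSqZeroExt.inr (Pi.single i 1), by
    rintro _ _ ⟨i, j⟩
    simp [θ]⟩

/-- The coefficient of `θ_j` in an element of `V^∧`. -/
def coord (j : Fin d) : X.Ext →ₗ[ℂ] ℂ :=
  LinearMap.proj j ∘ₗ (TrivSqZeroExt.sndHom ℂ (Fin d → ℂ)) ∘ₗ X.degOne.toLinearMap


theorem slice_comm (i j m n : Fin d) (a : A) :
    X.ν (sliceLeft (entry X.ν i m) a) j n = X.ν (sliceRight (entry X.ν j n) a) i m := by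
  simp only [sliceLeft, sliceRight, LinearMap.comp_apply]
  generalize Coalgebra.comul (R := ℂ) a = t
  induction t with
  | zero => simp
  | add x y hx hy => simp only [map_add, Matrix.add_apply, hx, hy]
  | tmul x y => simp [mul_comm]

theorem conv_apply (i j : Fin d) (a : A) :
    (WithConv.toConv (∑ m, (entry X.ν i m).smulRight (X.e m)) *
      WithConv.toConv (∑ n, (entry X.ν j n).smulRight (X.e n))).ofConv a =
    ∑ m, ∑ n, X.ν (sliceRight (entry X.ν j n) a) i m • (X.e m * X.e n) := by
  change LinearMap.mul' ℂ X.Ext (TensorProduct.map _ _ _) = _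
  simp only [sliceRight, LinearMap.comp_apply]
  generalize Coalgebra.comul (R := ℂ) a = t
  induction t with
  | zero => simp
  | add x y hx hy =>
    simp only [map_add, Matrix.add_apply, hx, hy, add_smul, Finset.sum_add_distrib]
  | tmul x y => simp [Finset.sum_mul_sum, smul_smul, mul_comm]

theorem sum_comm4 {M : Type*} [AddCommGroup M] (f : Fin d → Fin d → Fin d → Fin d → M) :
    ∑ m, ∑ n, ∑ k, ∑ l, f m n k l = ∑ k, ∑ l, ∑ m, ∑ n, f m n k l := by
  have h := Finset.sum_comm (s := Finset.univ) (t := Finset.univ)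
    (f := fun (x y : Fin d × Fin d) => f x.1 x.2 y.1 y.2)
  simpa only [Fintype.sum_prod_type] using h

theorem τ_coact (i j k l : Fin d) :
    ∑ p, ∑ q, X.τ p q i j • (X.ϰ k p * X.ϰ l q) = ∑ p, ∑ q, X.τ k l p q • (X.ϰ p i * X.ϰ q j) := by
  have h := X.yd i l (X.ϰ k j)
  simp [sliceRight, sliceLeft, X.comul_ϰ, Finset.sum_mul, Finset.mul_sum] at h
  rw [Finset.sum_comm]
  simpa [τ] using h

theorem sum_aux {E : Type*} [AddCommGroup E] [Module ℂ E] (E2 : Fin d → Fin d → E)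
    (t : Fin d → Fin d → Fin d → Fin d → ℂ) (c : Fin d → Fin d → Fin d → Fin d → ℂ) (i j : Fin d)
    (h : ∀ m n, ∑ k, ∑ l, t k l i j * c k m l n = ∑ p, ∑ l, c i p j l * t m n p l)
    (hE : ∀ p l, E2 p l + ∑ m, ∑ n, t m n p l • E2 m n = 0) :
    ∑ m, ∑ n, c i m j n • E2 m n + ∑ k, ∑ l, t k l i j • ∑ m, ∑ n, c k m l n • E2 m n = 0 := by
  calc _ = ∑ p, ∑ l, c i p j l • (E2 p l + ∑ m, ∑ n, t m n p l • E2 m n) := ?_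
    _ = 0 := by simp only [hE, smul_zero, Finset.sum_const_zero]
  simp only [smul_add, Finset.sum_add_distrib, Finset.smul_sum, smul_smul]
  congr 1
  refine (sum_comm4 _).trans (Eq.trans ?_ (sum_comm4 _))
  simp only [← Finset.sum_smul, h]

theorem circ_rel (i j : Fin d) (a : A) :
    ∑ m, ∑ n, X.ν (sliceRight (entry X.ν j n) a) i m • (X.e m * X.e n) +
      ∑ k, ∑ l, X.τ k l i j •
        ∑ m, ∑ n, X.ν (sliceRight (entry X.ν l n) a) k m • (X.e m * X.e n) = 0 := by
  refine sum_aux (fun m n => X.e m * X.e n) X.τ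
    (fun k m l n => X.ν (sliceRight (entry X.ν l n) a) k m) i j (fun m n => ?_) X.ext_rel
  have h := X.τ_circ i j m n a
  simp only [entry_apply, slice_comm] at h
  rw [Finset.sum_comm] at h
  simpa only [mul_comm] using h.symm

/-- The right `A`-module structure `∘` on `V^∧`, determined by
`(ϑη) ∘ a = (ϑ ∘ a⁽¹⁾)(η ∘ a⁽²⁾)`, `1 ∘ a = ε(a) 1`: the algebra map
`ϑ ↦ (a ↦ ϑ ∘ a)` to the convolution algebra of linear maps `A → V^∧`. -/
def circHom : X.Ext →ₐ[ℂ] WithConv (A →ₗ[ℂ] X.Ext) :=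
  RingQuot.liftAlgHom ℂ ⟨FreeAlgebra.lift ℂ fun i =>
    WithConv.toConv (∑ j, (entry X.ν i j).smulRight (X.e j)), by
    rintro _ _ ⟨i, j⟩
    ext a
    simp only [θ, map_add, map_mul, map_sum, map_smul, FreeAlgebra.lift_ι_apply, map_zero]
    change (_ : WithConv (A →ₗ[ℂ] X.Ext)).ofConv a = 0
    simp only [WithConv.ofConv_add, WithConv.ofConv_sum, WithConv.ofConv_smul,
      LinearMap.add_apply, LinearMap.sum_apply, LinearMap.smul_apply, conv_apply]
    exact X.circ_rel i j a⟩

theorem sum_aux2 {E C : Type*} [AddCommGroup E] [Module ℂ E] [AddCommGroup C] [Module ℂ C]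
    (E2 : Fin d → Fin d → E) (t : Fin d → Fin d → Fin d → Fin d → ℂ)
    (c : Fin d → Fin d → Fin d → Fin d → C) (i j : Fin d)
    (h : ∀ k l, ∑ p, ∑ q, t p q i j • c k p l q = ∑ p, ∑ q, t k l p q • c p i q j)
    (hE : ∀ p l, E2 p l + ∑ m, ∑ n, t m n p l • E2 m n = 0) :
    ∑ m, ∑ n, E2 m n ⊗ₜ[ℂ] c m i n j +
      ∑ k, ∑ l, t k l i j • ∑ m, ∑ n, E2 m n ⊗ₜ[ℂ] c m k n l = 0 := by
  calc _ = ∑ p, ∑ l, (E2 p l + ∑ m, ∑ n, t m n p l • E2 m n) ⊗ₜ[ℂ] c p i l j := ?_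
    _ = 0 := by simp only [hE, TensorProduct.zero_tmul, Finset.sum_const_zero]
  simp only [TensorProduct.add_tmul, Finset.sum_add_distrib, Finset.smul_sum,
    TensorProduct.sum_tmul, ← TensorProduct.smul_tmul']
  congr 1
  refine (sum_comm4 _).trans (Eq.trans ?_ (sum_comm4 _))
  simp only [← TensorProduct.tmul_smul, ← TensorProduct.tmul_sum, h]

theorem coact_rel (i j : Fin d) :
    ∑ m, ∑ n, (X.e m * X.e n) ⊗ₜ[ℂ] (X.ϰ m i * X.ϰ n j) +
      ∑ k, ∑ l, X.τ k l i j •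
        ∑ m, ∑ n, (X.e m * X.e n) ⊗ₜ[ℂ] (X.ϰ m k * X.ϰ n l) = 0 :=
  sum_aux2 (fun m n => X.e m * X.e n) X.τ (fun m i n j => X.ϰ m i * X.ϰ n j) i j
    (X.τ_coact i j) X.ext_rel

/-- The right coaction `ϰ : V^∧ → V^∧ ⊗ A`, multiplicative and extending `ϰ` on `V`. -/
def coactExt : X.Ext →ₐ[ℂ] X.Ext ⊗[ℂ] A :=
  RingQuot.liftAlgHom ℂ ⟨FreeAlgebra.lift ℂ fun i => ∑ j, X.e j ⊗ₜ[ℂ] X.ϰ j i, by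
    rintro _ _ ⟨i, j⟩
    simp only [θ, map_add, map_mul, map_sum, map_smul, FreeAlgebra.lift_ι_apply, map_zero]
    simp only [Finset.sum_mul_sum, Algebra.TensorProduct.tmul_mul_tmul]
    exact X.coact_rel i j⟩

end AbstractForms

/-! ### Quantum principal bundles and horizontal forms -/

/-- The product of two linear maps `M → M ⊗ A` and `N → N ⊗ A`, that is
`m ⊗ n ↦ ∑ m_k ⊗ n_l ⊗ c_k d_l`. -/
def prodCoact {A M N : Type*} [Ring A] [Algebra ℂ A] [AddCommGroup M] [Module ℂ M]
    [AddCommGroup N] [Module ℂ N] (f : M →ₗ[ℂ] M ⊗[ℂ] A) (g : N →ₗ[ℂ] N ⊗[ℂ] A) :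
    M ⊗[ℂ] N →ₗ[ℂ] (M ⊗[ℂ] N) ⊗[ℂ] A :=
  (LinearMap.mul' ℂ A).lTensor (M ⊗[ℂ] N) ∘ₗ
    (TensorProduct.tensorTensorTensorComm ℂ M A N A).toLinearMap ∘ₗ TensorProduct.map f g

/-- `ρ` is a (right) representation: `(ρ ⊗ id)ρ = (id ⊗ φ)ρ` and `(id ⊗ ε)ρ = id`. -/
structure IsCoaction {A M : Type*} [Ring A] [HopfAlgebra ℂ A] [AddCommGroup M] [Module ℂ M]
    (ρ : M →ₗ[ℂ] M ⊗[ℂ] A) : Prop where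
  coassoc : (TensorProduct.assoc ℂ M A A).toLinearMap ∘ₗ ρ.rTensor A ∘ₗ ρ =
    (Coalgebra.comul (R := ℂ) (A := A)).lTensor M ∘ₗ ρ
  counit : (TensorProduct.rid ℂ M).toLinearMap ∘ₗ
    (Coalgebra.counit (R := ℂ) (A := A)).lTensor M ∘ₗ ρ = LinearMap.id

/-- A quantum principal bundle `P = (B, i, F)`; the base algebra is identified with its image
under `i`, the fixed-point subalgebra of `F`. -/
structure PrincipalBundle (A B : Type*) [Ring A] [HopfAlgebra ℂ A] [StarRing A] [StarModule ℂ A]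
    [Ring B] [Algebra ℂ B] [StarRing B] [StarModule ℂ B] where
  F : B →ₐ[ℂ] B ⊗[ℂ] A
  F_star : ∀ b, F (star b) = star (F b)
  F_coaction : IsCoaction F.toLinearMap
  /-- Freeness: `q ⊗ b ↦ q F(b)` is onto `B ⊗ A`. -/
  free : Submodule.span ℂ {x | ∃ q b : B, x = (q ⊗ₜ[ℂ] (1 : A)) * F b} = ⊤

section Bundle

variable {A B : Type*} [Ring A] [HopfAlgebra ℂ A] [StarRing A] [StarModule ℂ A]
  [Ring B] [Algebra ℂ B] [StarRing B] [StarModule ℂ B] {d : ℕ}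

/-- The algebra of the base space: the fixed points of `F`. -/
def PrincipalBundle.base (P : PrincipalBundle A B) : Subalgebra ℂ B :=
  AlgHom.equalizer P.F Algebra.TensorProduct.includeLeft

/-- The space `𝔥𝔬𝔯_P = B ⊗ V^∧` of horizontal forms. -/
abbrev Hor (X : AbstractForms A d) (B : Type*) [Ring B] [Algebra ℂ B] : Type _ := B ⊗[ℂ] X.Ext

variable (P : PrincipalBundle A B) (X : AbstractForms A d)

/-- The action `ϑ ⊗ a ↦ ϑ ∘ a` as a linear map. -/
def AbstractForms.circ : X.Ext ⊗[ℂ] A →ₗ[ℂ] X.Ext :=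
  TensorProduct.lift ((WithConv.linearEquiv ℂ (A →ₗ[ℂ] X.Ext)).toLinearMap ∘ₗ
    X.circHom.toLinearMap)

/-- The product of horizontal forms,
`(q ⊗ ϑ)(b ⊗ η) = ∑_k q b_k ⊗ (ϑ ∘ c_k) η` where `F(b) = ∑_k b_k ⊗ c_k`. -/
def horMul : Hor X B →ₗ[ℂ] Hor X B →ₗ[ℂ] Hor X B :=
  TensorProduct.curry <|
    TensorProduct.map (LinearMap.mul' ℂ B) (LinearMap.mul' ℂ X.Ext ∘ₗ X.circ.rTensor X.Ext) ∘ₗ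
    (TensorProduct.assoc ℂ (B ⊗[ℂ] B) (X.Ext ⊗[ℂ] A) X.Ext).toLinearMap ∘ₗ
    (TensorProduct.tensorTensorTensorComm ℂ B X.Ext B A).toLinearMap.rTensor X.Ext ∘ₗ
    (TensorProduct.assoc ℂ (B ⊗[ℂ] X.Ext) (B ⊗[ℂ] A) X.Ext).symm.toLinearMap ∘ₗ
    (P.F.toLinearMap.rTensor X.Ext).lTensor (B ⊗[ℂ] X.Ext)

/-- The right action `F^∧` on horizontal forms, the product of `F` and `ϰ`. -/
def horCoact : Hor X B →ₗ[ℂ] Hor X B ⊗[ℂ] A :=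
  prodCoact P.F.toLinearMap X.coactExt.toLinearMap

/-- Horizontal forms of degree `n`. -/
def horDeg (B : Type*) [Ring B] [Algebra ℂ B] (n : ℕ) : Submodule ℂ (Hor X B) :=
  Submodule.span ℂ {x | ∃ b : B, ∃ ϑ ∈ (Submodule.span ℂ (Set.range X.e)) ^ n, x = b ⊗ₜ[ℂ] ϑ}

/-- A frame structure on `P`: the antiderivation `∇` of the algebra of horizontal forms
(the Levi-Civita connection) and its postulates. -/
structure FrameStructure where
  nabla : Hor X B →ₗ[ℂ] Hor X B
  /-- `∇` is of first order. -/
  nabla_deg : ∀ n, ∀ x ∈ horDeg X B n, nabla x ∈ horDeg X B (n + 1)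
  /-- The graded Leibniz rule. -/
  leibniz : ∀ n, ∀ x ∈ horDeg X B n, ∀ y,
    nabla (horMul P X x y) = horMul P X (nabla x) y + (-1 : ℂ) ^ n • horMul P X x (nabla y)
  /-- `∇` intertwines the action `F^∧`. -/
  covariant : horCoact P X ∘ₗ nabla = nabla.rTensor A ∘ₗ horCoact P X
  /-- `∇` vanishes on `V`. -/
  nabla_e : ∀ i, nabla (1 ⊗ₜ[ℂ] X.e i) = 0
  /-- `∇` vanishes on `∇(𝒱)`, where `𝒱` is the base algebra. -/
  nabla_nabla_base : ∀ f ∈ P.base, nabla (nabla (f ⊗ₜ[ℂ] 1)) = 0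
  /-- Hermiticity `∇(b^*) = ∇(b)^*`, where `(b ⊗ θ_j)^* = θ_j^* b^*`. For an antiderivation which
  vanishes on `V` this is the hermiticity on all horizontal forms. -/
  hermitian : ∀ b : B, nabla (star b ⊗ₜ[ℂ] 1) = ∑ j, ∑ k, X.J j k •
    horMul P X (1 ⊗ₜ[ℂ] X.e k)
      (star (TensorProduct.rid ℂ B ((X.coord j).lTensor B (nabla (b ⊗ₜ[ℂ] 1)))) ⊗ₜ[ℂ] 1)
  /-- Completeness: `1 ⊗ θ = ∑_α b_α(θ) ∇(f_α)` with `F(b_α(θ)) = (b_α ⊗ id)ϰ(θ)`. -/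
  complete : ∃ (N : ℕ) (b : Fin N → Fin d → B) (f : Fin N → B), (∀ α, f α ∈ P.base) ∧
    (∀ i, (1 : B) ⊗ₜ[ℂ] X.e i =
      ∑ α, horMul P X (b α i ⊗ₜ[ℂ] 1) (nabla (f α ⊗ₜ[ℂ] 1))) ∧
    ∀ α i, P.F (b α i) = ∑ j, b α j ⊗ₜ[ℂ] X.ϰ j i

variable {P X}

/-- The coordinate vector fields `∂_i : B → B`, where `∇(b) = ∑_i ∂_i(b) ⊗ θ_i`. -/
def FrameStructure.partialD (Φ : FrameStructure P X) (i : Fin d) : B →ₗ[ℂ] B :=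
  (TensorProduct.rid ℂ B).toLinearMap ∘ₗ (X.coord i).lTensor B ∘ₗ Φ.nabla ∘ₗ
    (TensorProduct.mk ℂ B X.Ext).flip 1

/-- `∇² : B → 𝔥𝔬𝔯_P`. -/
def FrameStructure.nablaSq (Φ : FrameStructure P X) : B →ₗ[ℂ] Hor X B :=
  Φ.nabla ∘ₗ Φ.nabla ∘ₗ (TensorProduct.mk ℂ B X.Ext).flip 1

/-- For a linear map `r : A → 𝔥𝔬𝔯_P` the map `b ↦ ∑_k b_k r(c_k)` where `F(b) = ∑_k b_k ⊗ c_k`. -/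
def contract (P : PrincipalBundle A B) {X : AbstractForms A d} (r : A →ₗ[ℂ] Hor X B) :
    B →ₗ[ℂ] Hor X B :=
  TensorProduct.lift ((horMul P X).compl₁₂ ((TensorProduct.mk ℂ B X.Ext).flip 1) r) ∘ₗ
    P.F.toLinearMap

/-- `r` is the curvature of `∇`: it is determined by `∇²(b) = - ∑_k b_k r(c_k)`. -/
def FrameStructure.IsCurvature (Φ : FrameStructure P X) (r : A →ₗ[ℂ] Hor X B) : Prop :=
  ∀ b, Φ.nablaSq b = - contract P r b

end Bundle

/-! ### Braid operators and braided exterior calculus on the tensor algebra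

Matrices `σ` with rows and columns indexed by `Fin d × Fin d` are operators on `V ⊗ V`:
`σ(θ_i ⊗ θ_j) = ∑_{kl} σ (k, l) (i, j) θ_k ⊗ θ_l`. -/

section Braid

variable {d : ℕ}

/-- Operators on `V ⊗ V`. -/
abbrev Op2 (d : ℕ) : Type := Matrix (Fin d × Fin d) (Fin d × Fin d) ℂ

/-- Operators on `V ⊗ V ⊗ V`. -/
abbrev Op3 (d : ℕ) : Type := Matrix (Fin d × Fin d × Fin d) (Fin d × Fin d × Fin d) ℂ

/-- Operators on `V ⊗ V ⊗ V ⊗ V`. -/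
abbrev Op4 (d : ℕ) : Type :=
  Matrix (Fin d × Fin d × Fin d × Fin d) (Fin d × Fin d × Fin d × Fin d) ℂ

/-- `σ ⊗ id` on `V^{⊗3}`. -/
def leg3L (σ : Op2 d) : Op3 d :=
  .of fun (a, b, c) (i, j, k) => if c = k then σ (a, b) (i, j) else 0

/-- `id ⊗ σ` on `V^{⊗3}`. -/
def leg3R (σ : Op2 d) : Op3 d :=
  .of fun (a, b, c) (i, j, k) => if a = i then σ (b, c) (j, k) else 0

/-- `ρ ⊗ σ` on `V^{⊗4}`. -/
def leg4LR (ρ σ : Op2 d) : Op4 d :=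
  .of fun (a, b, c, e) (i, j, k, l) => ρ (a, b) (i, j) * σ (c, e) (k, l)

/-- `id ⊗ σ ⊗ id` on `V^{⊗4}`. -/
def leg4M (σ : Op2 d) : Op4 d :=
  .of fun (a, b, c, e) (i, j, k, l) => if a = i ∧ e = l then σ (b, c) (j, k) else 0

/-- On words of length `n`, `∑_{k=0}^{n} (-1)^k σ_k σ_{k-1} ⋯ σ_1 (θ_i ⊗ ·)`, where `σ_k` is `σ`
acting on the tensor factors `k` and `k + 1`. -/
def insertWord (σ : Op2 d) : List (Fin d) → Fin d → Tens d
  | [], i => θ i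
  | k :: w, i => θ i * (θ k * word w) -
      ∑ a, ∑ b, σ (a, b) (i, k) • (θ a * insertWord σ w b)

/-- The braided antisymmetrizer on words. -/
def antisymWord (σ : Op2 d) : List (Fin d) → Tens d
  | [] => 1
  | i :: w => ofWords (fun u => insertWord σ u i) (antisymWord σ w)

/-- The total braided antisymmetrizer `A_σ : V^⊗ → V^⊗`, which in degree `n` is the alternating
sum `A_σ^n` of the braid operators `σ_π` of all permutations `π` of `n` letters. These are
computed by `A_σ^{n+1} = (∑_{k=0}^{n} (-1)^k σ_k ⋯ σ_1)(id ⊗ A_σ^n)`. -/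
def antisym (σ : Op2 d) : Tens d →ₗ[ℂ] Tens d := ofWords (antisymWord σ)

/-- The braiding `-σ` of `V` past `V^⊗`: `θ_i ⊗ t ↦ ∑_j S_{ij}(t) ⊗ θ_j`. -/
def pastBraid (σ : Op2 d) : Tens d →ₐ[ℂ] Matrix (Fin d) (Fin d) (Tens d) :=
  FreeAlgebra.lift ℂ fun k => .of fun i j => - ∑ l, σ (l, j) (i, k) • θ l

/-- Left multiplication by `φ(θ_i) = θ_i ⊗ 1 + 1 ⊗ θ_i` in the braided tensor product
`V^⊗ ⊗ V^⊗`: `a ⊗ b ↦ θ_i a ⊗ b + ∑_j S_{ij}(a) ⊗ θ_j b`. -/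
def coprodOp (σ : Op2 d) : Tens d →ₐ[ℂ] Module.End ℂ (Tens d ⊗[ℂ] Tens d) :=
  FreeAlgebra.lift ℂ fun i => (LinearMap.mulLeft ℂ (θ i)).rTensor (Tens d) +
    ∑ j, TensorProduct.map (entry (pastBraid σ) i j) (LinearMap.mulLeft ℂ (θ j))

/-- The coproduct `φ`, whose components `V^{⊗(k+l)} → V^{⊗k} ⊗ V^{⊗l}` are the braided inverse
shuffle operators `B_{kl}`: the braided-multiplicative map with `φ(θ_i) = θ_i ⊗ 1 + 1 ⊗ θ_i`. -/
def coprod (σ : Op2 d) : Tens d →ₗ[ℂ] Tens d ⊗[ℂ] Tens d :=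
  LinearMap.applyₗ (1 ⊗ₜ[ℂ] 1) ∘ₗ (coprodOp σ).toLinearMap

end Braid

/-! ### Quantum metrics and braided Clifford algebras -/

section Clifford

variable {A : Type*} [Ring A] [HopfAlgebra ℂ A] [StarRing A] [StarModule ℂ A] {d : ℕ}

/-- A quantum metric `g` on `V` with values in the `*`-algebra `Q` of abstract metric tensor
coefficients, together with a braid operator `σ` coupled to `τ`. -/
structure QuantumMetric (X : AbstractForms A d) (Q : Type*) [Ring Q] [Algebra ℂ Q] [StarRing Q]
    [StarModule ℂ Q] where
  σ : Op2 d
  isUnit_σ : IsUnit σ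
  /-- The braid equation. -/
  braid : leg3L σ * leg3R σ * leg3L σ = leg3R σ * leg3L σ * leg3R σ
  /-- `* σ = σ *` on `V ⊗ V`, where `(x ⊗ y)^* = y^* ⊗ x^*`. -/
  σ_star : ∀ i j m n, ∑ k, ∑ l, star (σ (k, l) (i, j)) * (X.J l m * X.J k n) =
    ∑ p, ∑ q, σ (m, n) (p, q) * (X.J j p * X.J i q)
  /-- The braids `σ` and `τ` are coupled: `V^∧` is also `V^⊗ / ker A_σ`. -/
  coupled : ∀ t : Tens d, X.toExt t = 0 ↔ antisym σ t = 0
  /-- The matrix `g_{ij} = g(θ_i, θ_j)`. -/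
  g : Matrix (Fin d) (Fin d) Q
  /-- Braided symmetry `g σ = g`. -/
  g_symm : ∀ i j, ∑ k, ∑ l, σ (k, l) (i, j) • g k l = g i j
  /-- Reality `g(x, y)^* = g(y^*, x^*)`. -/
  g_real : ∀ i j, star (g i j) = ∑ k, ∑ l, (X.J j k * X.J i l) • g k l
  /-- The compatibility of `g` and `σ`, with values in `Q` on `V^{⊗4}`:
  `g ⊗ g = (g ⊗ g)(id ⊗ σ ⊗ id)(σ⁻¹ ⊗ σ)(id ⊗ σ⁻¹ ⊗ id)`. -/
  g_σ : ∀ i j k l, g i j * g k l = ∑ a, ∑ b, ∑ c, ∑ e,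
    (leg4M σ * leg4LR σ⁻¹ σ * leg4M σ⁻¹) (a, b, c, e) (i, j, k, l) • (g a b * g c e)
  /-- `g ⊗ g = (g ⊗ g)(id ⊗ σ ⊗ id)(σ ⊗ σ⁻¹)(id ⊗ σ⁻¹ ⊗ id)`. -/
  g_σ' : ∀ i j k l, g i j * g k l = ∑ a, ∑ b, ∑ c, ∑ e,
    (leg4M σ * leg4LR σ σ⁻¹ * leg4M σ⁻¹) (a, b, c, e) (i, j, k, l) • (g a b * g c e)
  /-- The inverse of the matrix `g`. -/
  ginv : Matrix (Fin d) (Fin d) Q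
  g_mul_ginv : g * ginv = 1
  ginv_mul_g : ginv * g = 1
  /-- Minimality: `Q` is generated by the entries of `g` and of its inverse. -/
  generated : Algebra.adjoin ℂ ({q : Q | ∃ i j, q = g i j} ∪ {q : Q | ∃ i j, q = ginv i j}) = ⊤
  /-- The right `Q`-module structure `θ_i q = ∑_j ν_{ij}(q) θ_j` on `V_Q = Q ⊗ V`. -/
  ν : Q →ₐ[ℂ] Matrix (Fin d) (Fin d) Q
  /-- `ν(id ⊗ g) = (g ⊗ id)(id ⊗ σ)(σ⁻¹ ⊗ id)`. -/
  ν_g : ∀ i j k l, ν (g j k) i l =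
    ∑ a, ∑ b, ∑ c, (σ⁻¹ (a, b) (i, j) * σ (c, l) (b, k)) • g a c
  /-- The right coaction of `A` on `Q`, determined by `ϰ(g(x, y)) = (g ⊗ id)ϰ(x ⊗ y)`. -/
  coact : Q →ₐ[ℂ] Q ⊗[ℂ] A
  coact_star : ∀ q, coact (star q) = star (coact q)
  coact_g : ∀ i j, coact (g i j) = ∑ k, ∑ l, g k l ⊗ₜ[ℂ] (X.ϰ k i * X.ϰ l j)

namespace QuantumMetric

variable {X : AbstractForms A d} {Q : Type*} [Ring Q] [Algebra ℂ Q] [StarRing Q] [StarModule ℂ Q]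
  (G : QuantumMetric X Q)

/-- The tensor algebra `V_Q^⊗ = Q ⊗ V^⊗` of the bimodule `V_Q`. -/
abbrev TensQ (_ : QuantumMetric X Q) : Type _ := Q ⊗[ℂ] Tens d

/-- Left multiplication in `V_Q^⊗` by elements of `V^⊗`: `θ_i (q w) = ∑_j ν_{ij}(q) θ_j w`. -/
def leftMul : Tens d →ₐ[ℂ] Module.End ℂ G.TensQ :=
  FreeAlgebra.lift ℂ fun i =>
    ∑ j, TensorProduct.map (entry G.ν i j) (LinearMap.mulLeft ℂ (θ j))

/-- `θ_{y} w ↦ w`, all other words going to zero. -/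
def uncons (y : Fin d) : Tens d →ₗ[ℂ] Tens d :=
  ofWords fun
    | [] => 0
    | z :: w => if z = y then word w else 0

/-- Iterated contractions `x_1 ⊗ ⋯ ⊗ x_n ↦ c(x_1) ⋯ c(x_n)`, where
`c(x)(y ⊗ w) = g(x, y) w` is `Q`-bilinear: `c(θ_i)(q θ_y w) = ∑_j ν_{ij}(q) g_{jy} w`. -/
def contr : Tens d →ₐ[ℂ] Module.End ℂ G.TensQ :=
  FreeAlgebra.lift ℂ fun i => ∑ j, ∑ y,
    TensorProduct.map (LinearMap.mulRight ℂ (G.g j y) ∘ₗ entry G.ν i j) (uncons y)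

/-- The projection `V_Q^⊗ → Q` on the degree zero part. -/
def degZero : G.TensQ →ₗ[ℂ] Q :=
  (TensorProduct.rid ℂ Q).toLinearMap ∘ₗ
    (FreeAlgebra.lift ℂ (fun _ : Fin d => (0 : ℂ))).toLinearMap.lTensor Q

/-- The extended contraction `g` of `V^{⊗n}` and `V_Q^{⊗n}`, with
`g(ψ ⊗ x, y ⊗ ξ) = g(ψ, g(x, y) ξ)` and tensors of different degrees mutually orthogonal. -/
def gTens : Tens d →ₗ[ℂ] G.TensQ →ₗ[ℂ] Q :=
  LinearMap.llcomp ℂ G.TensQ G.TensQ Q G.degZero ∘ₗ G.contr.toLinearMap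

/-- The pairing `g_∧(ψ, ξ) = g(ψ, A_σ ξ)`. -/
def gWedge : Tens d →ₗ[ℂ] G.TensQ →ₗ[ℂ] Q :=
  G.gTens.compl₂ ((antisym G.σ).lTensor Q)

/-- The Clifford product `m̃ = m(id ⊗ g_∧ ⊗ id)(φ ⊗ φ)` on representatives in `V_Q^⊗`:
`(p s) m̃ (q t) = p ∑ s⁽¹⁾ g_∧(s⁽²⁾, q t⁽¹⁾) t⁽²⁾` for `p, q ∈ Q`, `s, t ∈ V^⊗`. -/
def cliffMul : G.TensQ →ₗ[ℂ] G.TensQ →ₗ[ℂ] G.TensQ :=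
  TensorProduct.curry <|
    (LinearMap.mul' ℂ Q).rTensor (Tens d) ∘ₗ
    (TensorProduct.assoc ℂ Q Q (Tens d)).symm.toLinearMap ∘ₗ
    (TensorProduct.lift G.leftMul.toLinearMap ∘ₗ
      ((TensorProduct.lift G.gWedge).rTensor (Tens d) ∘ₗ
        (TensorProduct.assoc ℂ (Tens d) (Q ⊗[ℂ] Tens d) (Tens d)).symm.toLinearMap ∘ₗ
        (TensorProduct.assoc ℂ Q (Tens d) (Tens d)).symm.toLinearMap.lTensor
          (Tens d)).lTensor (Tens d) ∘ₗ
      (TensorProduct.assoc ℂ (Tens d) (Tens d)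
        (Q ⊗[ℂ] (Tens d ⊗[ℂ] Tens d))).toLinearMap).lTensor Q ∘ₗ
    (TensorProduct.assoc ℂ Q (Tens d ⊗[ℂ] Tens d) (Q ⊗[ℂ] (Tens d ⊗[ℂ] Tens d))).toLinearMap ∘ₗ
    TensorProduct.map ((coprod G.σ).lTensor Q) ((coprod G.σ).lTensor Q)

/-- The extended braided exterior algebra `V_Q^∧ = Q ⊗ V^∧`, as a space. -/
abbrev ExtQ (_ : QuantumMetric X Q) : Type _ := Q ⊗[ℂ] X.Ext

/-- The projection `V_Q^⊗ → V_Q^∧`. -/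
def toExtQ : G.TensQ →ₗ[ℂ] G.ExtQ := X.toExt.toLinearMap.lTensor Q

/-- The multiplication table of the Clifford algebra: the product of the classes of `s` and `t`
is the class of `s m̃ t`, and the unit is the unit of `V_Q^∧`. -/
inductive CliffRel : TensorAlgebra ℂ G.ExtQ → TensorAlgebra ℂ G.ExtQ → Prop
  | one : CliffRel (TensorAlgebra.ι ℂ (1 ⊗ₜ[ℂ] 1)) 1
  | mul (s t : G.TensQ) :
      CliffRel (TensorAlgebra.ι ℂ (G.toExtQ s) * TensorAlgebra.ι ℂ (G.toExtQ t))
        (TensorAlgebra.ι ℂ (G.toExtQ (G.cliffMul s t)))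

/-- The braided Clifford algebra: the space `V_Q^∧` with the product `m̃`, that is, the unital
algebra on the elements of `V_Q^∧` with the multiplication table `m̃`. -/
abbrev Cliff : Type _ := RingQuot G.CliffRel

/-- The identification of `V_Q^∧` with the Clifford algebra. -/
def toCliff : G.ExtQ →ₗ[ℂ] G.Cliff :=
  (RingQuot.mkAlgHom ℂ G.CliffRel).toLinearMap ∘ₗ TensorAlgebra.ι ℂ

/-- The right coaction of `A` on the Clifford algebra `V_Q^∧ = Q ⊗ V^∧`, the product of the
coactions on `Q` and on `V^∧`. -/
def coactCliff : G.ExtQ →ₗ[ℂ] G.ExtQ ⊗[ℂ] A :=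
  prodCoact G.coact.toLinearMap X.coactExt.toLinearMap

end QuantumMetric

/-- A quantum spinor space: a finite-dimensional Hilbert space `S` with a unitary representation
of the quantum group and an irreducible left `*`-module structure over the Clifford algebra,
covariant in the sense that `ϰ_S(Zξ) = ϰ(Z) ϰ_S(ξ)`. -/
structure SpinorSpace {X : AbstractForms A d} {Q : Type*} [Ring Q] [Algebra ℂ Q] [StarRing Q]
    [StarModule ℂ Q] (G : QuantumMetric X Q) (S : Type*) [NormedAddCommGroup S]
    [InnerProductSpace ℂ S] [FiniteDimensional ℂ S] where
  /-- The representation of the quantum group. -/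
  ϰ : S →ₗ[ℂ] S ⊗[ℂ] A
  ϰ_coaction : IsCoaction ϰ
  /-- The matrix of the representation in an orthonormal basis is unitary. -/
  ϰ_unitary : (Matrix.of fun i j => TensorProduct.lid ℂ A
    (((stdOrthonormalBasis ℂ S).toBasis.coord i).rTensor A (ϰ (stdOrthonormalBasis ℂ S j)))) ∈
      unitary (Matrix (Fin (Module.finrank ℂ S)) (Fin (Module.finrank ℂ S)) A)
  /-- The module structure over the Clifford algebra. -/
  γ : G.Cliff →ₐ[ℂ] Module.End ℂ S
  /-- `γ(x^*) = γ(x)^†` for `x ∈ V`. -/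
  γ_star : ∀ i, LinearMap.adjoint (γ (G.toCliff (1 ⊗ₜ[ℂ] X.e i))) =
    ∑ j, X.J i j • γ (G.toCliff (1 ⊗ₜ[ℂ] X.e j))
  /-- `γ(q^*) = γ(q)^†` for `q ∈ Q`; the Clifford algebra is generated by `V` and `Q`. -/
  γ_star' : ∀ q, LinearMap.adjoint (γ (G.toCliff (q ⊗ₜ[ℂ] 1))) =
    γ (G.toCliff (star q ⊗ₜ[ℂ] 1))
  nontrivial : Nontrivial S
  irreducible : ∀ W : Submodule ℂ S, (∀ z, ∀ ξ ∈ W, γ z ξ ∈ W) → W = ⊥ ∨ W = ⊤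
  covariant : ∀ (Z : G.ExtQ) (ξ : S), ϰ (γ (G.toCliff Z) ξ) =
    TensorProduct.map₂ (γ.toLinearMap ∘ₗ G.toCliff) (LinearMap.mul ℂ A) (G.coactCliff Z) (ϰ ξ)

end Clifford

/-! ### The spinor bundle, the Dirac operator and the spinorial Laplacian -/

section Dirac

variable {A B Q S : Type*} [Ring A] [HopfAlgebra ℂ A] [StarRing A] [StarModule ℂ A]
  [Ring B] [Algebra ℂ B] [StarRing B] [StarModule ℂ B]
  [Ring Q] [Algebra ℂ Q] [StarRing Q] [StarModule ℂ Q]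
  [NormedAddCommGroup S] [InnerProductSpace ℂ S] [FiniteDimensional ℂ S] {d : ℕ}
  {P : PrincipalBundle A B} {X : AbstractForms A d} {G : QuantumMetric X Q}

/-- The right action of the quantum group on `𝒮 = B ⊗ S`, the product of `F` and `ϰ_S`. -/
def spinCoact (P : PrincipalBundle A B) (Y : SpinorSpace G S) :
    B ⊗[ℂ] S →ₗ[ℂ] (B ⊗[ℂ] S) ⊗[ℂ] A :=
  prodCoact P.F.toLinearMap Y.ϰ

/-- The quantum spinor bundle `𝒮_M`: the invariant elements of `𝒮 = B ⊗ S`. -/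
def spinorBundle (P : PrincipalBundle A B) (Y : SpinorSpace G S) : Submodule ℂ (B ⊗[ℂ] S) :=
  LinearMap.eqLocus (spinCoact P Y) ((TensorProduct.mk ℂ (B ⊗[ℂ] S) A).flip 1)

/-- The quantum Dirac operator `D = -i ∑_j ∂_j ⊗ θ_j`. -/
def dirac (Φ : FrameStructure P X) (Y : SpinorSpace G S) : B ⊗[ℂ] S →ₗ[ℂ] B ⊗[ℂ] S :=
  (-Complex.I) • ∑ j, TensorProduct.map (Φ.partialD j) (Y.γ (G.toCliff (1 ⊗ₜ[ℂ] X.e j)))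

/-- The spinorial Laplacian `Δ_𝒮 = - ∑_{ij} ∂_i ∂_j ⊗ g_{ij}`. -/
def spinLaplacian (Φ : FrameStructure P X) (Y : SpinorSpace G S) :
    B ⊗[ℂ] S →ₗ[ℂ] B ⊗[ℂ] S :=
  - ∑ i, ∑ j, TensorProduct.map (Φ.partialD i ∘ₗ Φ.partialD j) (Y.γ (G.toCliff (G.g i j ⊗ₜ[ℂ] 1)))

/-- The cliffordization of a horizontal form: the form `∑ b ⊗ ϑ`, viewed through the
identification of `V_Q^∧` with the Clifford algebra, as the map `ξ ↦ ∑ b ⊗ ϑ[ξ]` from `S` to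
`B ⊗ S`. -/
def cliffordize (Y : SpinorSpace G S) : Hor X B →ₗ[ℂ] S →ₗ[ℂ] B ⊗[ℂ] S :=
  TensorProduct.curry <|
    (TensorProduct.lift (Y.γ.toLinearMap ∘ₗ G.toCliff ∘ₗ TensorProduct.mk ℂ Q X.Ext 1)).lTensor B ∘ₗ
    (TensorProduct.assoc ℂ B X.Ext S).toLinearMap

/-- The operator on `𝒮` obtained by cliffordization from a linear map `B → 𝔥𝔬𝔯_P`:
`b ⊗ ξ ↦ T(b)[ξ]`. -/
def cliffordOp (Y : SpinorSpace G S) (T : B →ₗ[ℂ] Hor X B) : B ⊗[ℂ] S →ₗ[ℂ] B ⊗[ℂ] S :=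
  TensorProduct.lift (cliffordize Y ∘ₗ T)

/-- The curvature term `R̂`, which corresponds to `∇²`:
`R̂(b ⊗ ξ) = - ∇²(b)[ξ]`; the sign is that of `(-i)²`. -/
def curvatureTerm (Φ : FrameStructure P X) (Y : SpinorSpace G S) :
    B ⊗[ℂ] S →ₗ[ℂ] B ⊗[ℂ] S :=
  - cliffordOp Y Φ.nablaSq

end Dirac

end QuantumSpin
end

open scoped TensorProduct

noncomputable section

set_option linter.unusedSectionVars false

namespace QuantumSpin

/-! ### Horizontal forms of degree at most two and the coordinate fields. -/

section Forms

variable {A B : Type*} [Ring A] [HopfAlgebra ℂ A] [StarRing A] [StarModule ℂ A]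
  [Ring B] [Algebra ℂ B] [StarRing B] [StarModule ℂ B] {d : ℕ}
  {P : PrincipalBundle A B} {X : AbstractForms A d}

/-! Applying `dirac` twice to `b ⊗ ξ` gives `-∑ ∂_i ∂_j b ⊗ θ_i[θ_j[ξ]]`, the sign being `(-i)²`. In
the Clifford algebra `θ_i θ_j` is the exterior product `θ_i ∧ θ_j` plus the scalar part `g_ij`
(`QuantumMetric.toCliff_e_mul_toCliff_e`): each `θ` has coproduct `θ ⊗ 1 + 1 ⊗ θ`, and the
antisymmetrizer is the identity in degrees zero and one. The scalar part sums to the Laplacian. The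
exterior part sums to `-∇²(b)[ξ]`, because `∇` is an antiderivation vanishing on `V`, so that `∇²(b)
= ∑ ∂_i ∂_j b ⊗ θ_i θ_j` (`FrameStructure.nablaSq_apply`). The derivatives and the vectors come in
the same index order, so nothing has to be commuted, and `dirac_dirac` holds on all of `B ⊗ S`, not
only on invariant elements.

Invariance uses a coordinate-free description: `dirac` and `curvatureTerm` are, up to constants,
Clifford actions of `∇` and `∇²` restricted to `B`. The Clifford action of any covariant map `B →
𝔥𝔬𝔯_P` intertwines the coaction on spinors (`spinCoact_cliffordOp`), hence preserves the invariant
elements. The Laplacian is then the difference of two operators that preserve them. The formula with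
`r` is the definition of a curvature, up to sign. -/

theorem AbstractForms.coord_e (i j : Fin d) : X.coord i (X.e j) = if i = j then 1 else 0 := by
  have h : X.degOne (X.e j) = TrivSqZeroExt.inr (Pi.single j 1) := by
    simp [degOne, e, toExt, θ]
  simp [coord, h, Pi.single_apply]

/-- Since `1` is group-like, evaluation at `1` is an algebra map on the convolution algebra. So `ϑ ↦
ϑ ∘ 1` is an algebra endomorphism of `V^∧`, and it fixes the generators because `ν(1)` is the
identity matrix. -/
theorem AbstractForms.circ_tmul_one (ϑ : X.Ext) : X.circ (ϑ ⊗ₜ[ℂ] 1) = ϑ := by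
  have h : ∀ f g : WithConv (A →ₗ[ℂ] X.Ext), (f * g).ofConv 1 = f.ofConv 1 * g.ofConv 1 := by
    intro f g
    change LinearMap.mul' ℂ X.Ext (TensorProduct.map _ _ (Coalgebra.comul (R := ℂ) (1 : A))) = _
    simp [Bialgebra.comul_one, Algebra.TensorProduct.one_def]
  have h1 : (1 : WithConv (A →ₗ[ℂ] X.Ext)).ofConv 1 = 1 := by
    change algebraMap ℂ X.Ext (Coalgebra.counit (R := ℂ) (1 : A)) = 1
    simp
  let ev : WithConv (A →ₗ[ℂ] X.Ext) →ₐ[ℂ] X.Ext :=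
    AlgHom.ofLinearMap
      ((LinearMap.applyₗ (1 : A)) ∘ₗ (WithConv.linearEquiv ℂ (A →ₗ[ℂ] X.Ext)).toLinearMap)
      h1 h
  have key : ev.comp X.circHom = AlgHom.id ℂ X.Ext := by
    apply RingQuot.ringQuot_ext'
    ext i
    change (X.circHom (X.e i)).ofConv 1 = X.e i
    simp [circHom, e, toExt, θ, Matrix.one_apply]
  exact congrArg (fun f => f ϑ) key

/-- The twist in the product disappears because `F(1) = 1 ⊗ 1` and `1` acts trivially through `∘`.
-/
theorem horMul_tmul_one_tmul (b : B) (ϑ η : X.Ext) :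
    horMul P X (b ⊗ₜ[ℂ] ϑ) (1 ⊗ₜ[ℂ] η) = b ⊗ₜ[ℂ] (ϑ * η) := by
  simp [horMul, Algebra.TensorProduct.one_def, AbstractForms.circ_tmul_one]

theorem mem_horDeg_zero (b : B) : b ⊗ₜ[ℂ] (1 : X.Ext) ∈ horDeg X B 0 :=
  Submodule.subset_span ⟨b, 1, by simp [Submodule.one_le.mp le_rfl], rfl⟩

/-- The relations of `V^∧` start in degree two, so the `θ_i` stay independent there and `coord` is
their dual basis. This is what identifies the components `partialD` with the whole of `∇(b)`. -/
theorem eq_sum_of_mem_horDeg_one {x : Hor X B} (hx : x ∈ horDeg X B 1) :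
    x = ∑ i, (TensorProduct.rid ℂ B ((X.coord i).lTensor B x)) ⊗ₜ[ℂ] X.e i := by
  induction hx using Submodule.span_induction with
  | zero => simp
  | add x y _ _ hx hy =>
    simp only [map_add, TensorProduct.add_tmul, Finset.sum_add_distrib]
    rw [← hx, ← hy]
  | smul c x _ hx =>
    simp only [map_smul, ← TensorProduct.smul_tmul', ← Finset.smul_sum]
    rw [← hx]
  | mem x hx =>
    obtain ⟨b, ϑ, hϑ, rfl⟩ := hx
    rw [pow_one] at hϑ
    have h : ϑ = ∑ i, X.coord i ϑ • X.e i := by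
      induction hϑ using Submodule.span_induction with
      | zero => simp
      | add x y _ _ hx hy =>
        simp only [map_add, add_smul, Finset.sum_add_distrib]
        rw [← hx, ← hy]
      | smul c x _ hx =>
        simp only [map_smul, smul_assoc, ← Finset.smul_sum]
        rw [← hx]
      | mem x hx =>
        obtain ⟨j, rfl⟩ := hx
        simp [AbstractForms.coord_e]
    conv_lhs => rw [h]
    simp [TensorProduct.tmul_sum, TensorProduct.smul_tmul']

namespace FrameStructure

variable (Φ : FrameStructure P X)

theorem nabla_tmul_one (b : B) : Φ.nabla (b ⊗ₜ[ℂ] 1) = ∑ i, Φ.partialD i b ⊗ₜ[ℂ] X.e i :=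
  eq_sum_of_mem_horDeg_one (Φ.nabla_deg 0 _ (mem_horDeg_zero b))

/-- Leibniz rule for `(b ⊗ 1)(1 ⊗ θ_j)`; the second term dies because `∇` vanishes on `V`. -/
theorem nabla_tmul_e (b : B) (j : Fin d) :
    Φ.nabla (b ⊗ₜ[ℂ] X.e j) = ∑ i, Φ.partialD i b ⊗ₜ[ℂ] (X.e i * X.e j) := by
  have h := Φ.leibniz 0 _ (mem_horDeg_zero b) (1 ⊗ₜ[ℂ] X.e j)
  rw [horMul_tmul_one_tmul, one_mul, Φ.nabla_e, map_zero, smul_zero, add_zero,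
    nabla_tmul_one, map_sum, LinearMap.sum_apply] at h
  simpa only [horMul_tmul_one_tmul] using h

theorem nablaSq_apply (b : B) :
    Φ.nablaSq b = ∑ i, ∑ j, Φ.partialD i (Φ.partialD j b) ⊗ₜ[ℂ] (X.e i * X.e j) := by
  change Φ.nabla (Φ.nabla (b ⊗ₜ[ℂ] 1)) = _
  -- The outer `∇` puts its vector `θ_i` to the left of the earlier `θ_j`, which matches the order
  -- of `∂_i ∂_j`.
  rw [nabla_tmul_one, map_sum, Finset.sum_comm]
  simp only [nabla_tmul_e]

/-- The restriction of `∇` to `B`. -/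
def nablaBase : B →ₗ[ℂ] Hor X B := Φ.nabla ∘ₗ (TensorProduct.mk ℂ B X.Ext).flip 1

end FrameStructure

/-! ### Covariance of `∇` and `∇²` on `B`. -/

theorem prodCoact_tmul_one {M R : Type*} [AddCommGroup M] [Module ℂ M] [Ring R] [Algebra ℂ R]
    (f : M →ₗ[ℂ] M ⊗[ℂ] A) (g : R →ₐ[ℂ] R ⊗[ℂ] A) (m : M) :
    prodCoact f g.toLinearMap (m ⊗ₜ[ℂ] 1) = ((TensorProduct.mk ℂ M R).flip 1).rTensor A (f m) := by
  simp only [prodCoact, LinearMap.comp_apply, TensorProduct.map_tmul, AlgHom.toLinearMap_apply,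
    map_one, Algebra.TensorProduct.one_def]
  generalize f m = t
  induction t with
  | zero => simp
  | add x y hx hy => simp only [map_add, TensorProduct.add_tmul, hx, hy]
  | tmul x y => simp

theorem prodCoact_one_tmul {M R : Type*} [AddCommGroup M] [Module ℂ M] [Ring R] [Algebra ℂ R]
    (f : R →ₐ[ℂ] R ⊗[ℂ] A) (g : M →ₗ[ℂ] M ⊗[ℂ] A) (m : M) :
    prodCoact f.toLinearMap g (1 ⊗ₜ[ℂ] m) = (TensorProduct.mk ℂ R M 1).rTensor A (g m) := by
  simp only [prodCoact, LinearMap.comp_apply, TensorProduct.map_tmul, AlgHom.toLinearMap_apply,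
    map_one, Algebra.TensorProduct.one_def]
  generalize g m = t
  induction t with
  | zero => simp
  | add x y hx hy => simp only [map_add, TensorProduct.tmul_add, hx, hy]
  | tmul x y => simp

/-- A linear map `B → 𝔥𝔬𝔯_P` intertwining `F` and `F^∧`. -/
def IsCovariant (P : PrincipalBundle A B) (T : B →ₗ[ℂ] Hor X B) : Prop :=
  ∀ b, horCoact P X (T b) = T.rTensor A (P.F b)

theorem FrameStructure.horCoact_nabla (Φ : FrameStructure P X) (x : Hor X B) :
    horCoact P X (Φ.nabla x) = Φ.nabla.rTensor A (horCoact P X x) :=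
  LinearMap.congr_fun Φ.covariant x

theorem FrameStructure.isCovariant_nablaBase (Φ : FrameStructure P X) :
    IsCovariant P Φ.nablaBase := by
  intro b
  simp only [nablaBase, LinearMap.comp_apply, LinearMap.flip_apply, TensorProduct.mk_apply,
    horCoact_nabla, LinearMap.rTensor_comp]
  rw [horCoact, prodCoact_tmul_one]
  rfl

theorem FrameStructure.isCovariant_nablaSq (Φ : FrameStructure P X) :
    IsCovariant P Φ.nablaSq := by
  intro b
  change horCoact P X (Φ.nabla (Φ.nablaBase b)) = (Φ.nabla ∘ₗ Φ.nablaBase).rTensor A (P.F b)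
  rw [horCoact_nabla, Φ.isCovariant_nablaBase, LinearMap.rTensor_comp_apply]

end Forms

/-! ### The Clifford product of two vectors. -/

section Clifford

variable {A Q : Type*} [Ring A] [HopfAlgebra ℂ A] [StarRing A] [StarModule ℂ A]
  [Ring Q] [Algebra ℂ Q] [StarRing Q] [StarModule ℂ Q] {d : ℕ} {X : AbstractForms A d}

theorem coprod_θ (σ : Op2 d) (i : Fin d) :
    coprod σ (θ i) = θ i ⊗ₜ[ℂ] 1 + 1 ⊗ₜ[ℂ] θ i := by
  simp [coprod, coprodOp, θ, Matrix.one_apply, TensorProduct.ite_tmul]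

theorem word_singleton (i : Fin d) : word [i] = θ i := by simp [word]

theorem word_nil : word ([] : List (Fin d)) = 1 := rfl

theorem antisym_one (σ : Op2 d) : antisym σ 1 = 1 := by
  rw [antisym, ← word_nil, ofWords_word]
  rfl

/-- There is nothing to permute in degree one, so `gWedge` agrees with `gTens` on single vectors. -/
theorem antisym_θ (σ : Op2 d) (i : Fin d) : antisym σ (θ i) = θ i := by
  rw [antisym, ← word_singleton, ofWords_word, antisymWord, antisymWord, ← word_nil,
    ofWords_word, insertWord, word_singleton]

theorem lift_zero_θ (i : Fin d) : FreeAlgebra.lift ℂ (fun _ : Fin d => (0 : ℂ)) (θ i) = 0 := by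
  simp [θ]

namespace QuantumMetric

variable (G : QuantumMetric X Q)

theorem uncons_θ (y i : Fin d) : uncons y (θ i) = if i = y then 1 else 0 := by
  rw [uncons, ← word_singleton, ofWords_word]
  rfl

theorem uncons_one (y : Fin d) : uncons y 1 = 0 := by
  rw [uncons, ← word_nil, ofWords_word]

theorem gWedge_one_one : G.gWedge 1 (1 ⊗ₜ[ℂ] 1) = 1 := by
  simp [gWedge, gTens, antisym_one, degZero]

/-- Together with `gWedge_θ_one` this is orthogonality of degrees zero and one: here a vector is
left uncontracted and `degZero` kills it, there `uncons` finds no letter to contract. -/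
theorem gWedge_one_θ (i : Fin d) : G.gWedge 1 (1 ⊗ₜ[ℂ] θ i) = 0 := by
  simp [gWedge, gTens, antisym_θ, degZero, lift_zero_θ]

theorem contr_θ (i : Fin d) : G.contr (θ i) = ∑ j, ∑ y,
    TensorProduct.map (LinearMap.mulRight ℂ (G.g j y) ∘ₗ entry G.ν i j) (uncons y) := by
  simp [contr, θ]

theorem gWedge_θ_one (i : Fin d) : G.gWedge (θ i) (1 ⊗ₜ[ℂ] 1) = 0 := by
  simp [gWedge, gTens, antisym_one, contr_θ, uncons_one]

theorem gWedge_θ_θ (i j : Fin d) : G.gWedge (θ i) (1 ⊗ₜ[ℂ] θ j) = G.g i j := by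
  simp [gWedge, gTens, antisym_θ, contr_θ, uncons_θ, degZero,
    Matrix.one_apply, apply_ite]

theorem leftMul_θ_one_tmul (i : Fin d) (t : Tens d) :
    G.leftMul (θ i) (1 ⊗ₜ[ℂ] t) = 1 ⊗ₜ[ℂ] (θ i * t) := by
  simp [leftMul, θ, Matrix.one_apply, TensorProduct.ite_tmul]

/-- The two coproducts give four terms. Pairing `1` with `1` leaves `θ_i θ_j`, pairing `θ_i` with
`θ_j` leaves `g_ij`, and the two mixed pairings vanish by degree. -/
theorem cliffMul_θ_θ (i j : Fin d) :
    G.cliffMul (1 ⊗ₜ[ℂ] θ i) (1 ⊗ₜ[ℂ] θ j) =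
      1 ⊗ₜ[ℂ] (θ i * θ j) + G.g i j ⊗ₜ[ℂ] 1 := by
  simp [cliffMul, coprod_θ, TensorProduct.tmul_add, TensorProduct.add_tmul, gWedge_one_one,
    gWedge_one_θ, gWedge_θ_one, gWedge_θ_θ, leftMul_θ_one_tmul, add_comm]

theorem toCliff_e_mul_toCliff_e (i j : Fin d) :
    G.toCliff (1 ⊗ₜ[ℂ] X.e i) * G.toCliff (1 ⊗ₜ[ℂ] X.e j) =
      G.toCliff (1 ⊗ₜ[ℂ] (X.e i * X.e j)) + G.toCliff (G.g i j ⊗ₜ[ℂ] 1) := by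
  have h := RingQuot.mkAlgHom_rel ℂ (CliffRel.mul (G := G) (1 ⊗ₜ[ℂ] θ i) (1 ⊗ₜ[ℂ] θ j))
  rw [map_mul, cliffMul_θ_θ, map_add, map_add, map_add] at h
  simpa [toExtQ, AbstractForms.e, toCliff] using h

end QuantumMetric

end Clifford

/-! ### The square of the Dirac operator. -/

section Dirac

variable {A B Q S : Type*} [Ring A] [HopfAlgebra ℂ A] [StarRing A] [StarModule ℂ A]
  [Ring B] [Algebra ℂ B] [StarRing B] [StarModule ℂ B]
  [Ring Q] [Algebra ℂ Q] [StarRing Q] [StarModule ℂ Q]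
  [NormedAddCommGroup S] [InnerProductSpace ℂ S] [FiniteDimensional ℂ S] {d : ℕ}
  {P : PrincipalBundle A B} {X : AbstractForms A d} {G : QuantumMetric X Q}

@[simp] theorem cliffordize_tmul (Y : SpinorSpace G S) (b : B) (ϑ : X.Ext) (ξ : S) :
    cliffordize Y (b ⊗ₜ[ℂ] ϑ) ξ = b ⊗ₜ[ℂ] Y.γ (G.toCliff (1 ⊗ₜ[ℂ] ϑ)) ξ := by
  simp [cliffordize]

@[simp] theorem cliffordOp_tmul (Y : SpinorSpace G S) (T : B →ₗ[ℂ] Hor X B) (b : B) (ξ : S) :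
    cliffordOp Y T (b ⊗ₜ[ℂ] ξ) = cliffordize Y (T b) ξ := by
  simp [cliffordOp]

/-- The form without coordinates makes covariance accessible: the individual `∂_j` mix under the
coaction, while `∇` as a whole intertwines it. -/
theorem dirac_eq_cliffordOp (Φ : FrameStructure P X) (Y : SpinorSpace G S) :
    dirac Φ Y = (-Complex.I) • cliffordOp Y Φ.nablaBase := by
  ext b ξ
  simp [dirac, FrameStructure.nablaBase, FrameStructure.nabla_tmul_one]

theorem dirac_dirac (Φ : FrameStructure P X) (Y : SpinorSpace G S) (ψ : B ⊗[ℂ] S) :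
    dirac Φ Y (dirac Φ Y ψ) = spinLaplacian Φ Y ψ + curvatureTerm Φ Y ψ := by
  induction ψ with
  | zero => simp
  | add x y hx hy => simp only [map_add, hx, hy]; abel
  | tmul b ξ =>
    have h : ∀ i j (ξ : S), Y.γ (G.toCliff (1 ⊗ₜ[ℂ] X.e i)) (Y.γ (G.toCliff (1 ⊗ₜ[ℂ] X.e j)) ξ) =
        Y.γ (G.toCliff (1 ⊗ₜ[ℂ] (X.e i * X.e j))) ξ + Y.γ (G.toCliff (G.g i j ⊗ₜ[ℂ] 1)) ξ := by
      intro i j ξ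
      rw [← Module.End.mul_apply, ← map_mul, G.toCliff_e_mul_toCliff_e, map_add,
        LinearMap.add_apply]
    have hD : ∀ (b : B) (ξ : S), dirac Φ Y (b ⊗ₜ[ℂ] ξ) = -Complex.I •
        ∑ j, Φ.partialD j b ⊗ₜ[ℂ] Y.γ (G.toCliff (1 ⊗ₜ[ℂ] X.e j)) ξ := by
      intro b ξ
      rw [dirac, LinearMap.smul_apply, LinearMap.sum_apply]
      rfl
    -- The source of the minus signs in both the Laplacian and the curvature term.
    have hI : (-Complex.I) * (-Complex.I) = -1 := by simp
    rw [hD, map_smul, map_sum]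
    simp only [hD, h, ← Finset.smul_sum, smul_smul, hI]
    simp only [spinLaplacian, curvatureTerm, LinearMap.sum_apply, LinearMap.neg_apply,
      TensorProduct.map_tmul, map_sum, cliffordOp_tmul, FrameStructure.nablaSq_apply,
      cliffordize_tmul, LinearMap.comp_apply, TensorProduct.tmul_add, Finset.sum_add_distrib,
      neg_smul, one_smul]
    rw [neg_add, add_comm]
    -- The inner Dirac operator contributes the outer sum over `j`, whereas both targets sum over
    -- `i` outermost.
    congr 2 <;> exact Finset.sum_comm

/-! ### Invariance of the spinor bundle under the three operators. -/

/-- The action of `𝔥𝔬𝔯_P ⊗ A` on `S ⊗ A`, `(ω ⊗ a)(ξ ⊗ c) = ω[ξ] ⊗ a c`. -/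
def cliffordizeCoact (Y : SpinorSpace G S) :
    Hor X B ⊗[ℂ] A →ₗ[ℂ] S ⊗[ℂ] A →ₗ[ℂ] (B ⊗[ℂ] S) ⊗[ℂ] A :=
  TensorProduct.map₂ (cliffordize Y) (LinearMap.mul ℂ A)

theorem spinCoact_cliffordize (Y : SpinorSpace G S) (ω : Hor X B) (ξ : S) :
    spinCoact P Y (cliffordize Y ω ξ) = cliffordizeCoact Y (horCoact P X ω) (Y.ϰ ξ) := by
  induction ω using TensorProduct.induction_on with
  | zero => simp
  | add x y hx hy => simp only [map_add, LinearMap.add_apply, hx, hy]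
  | tmul b ϑ =>
    -- The coaction on `Q` fixes `1`, so the Clifford coaction of `1 ⊗ ϑ` is just that of `ϑ` in
    -- `V^∧`.
    have hϑ : G.coactCliff (1 ⊗ₜ[ℂ] ϑ) =
        (TensorProduct.mk ℂ Q X.Ext 1).rTensor A (X.coactExt ϑ) := prodCoact_one_tmul _ _ _
    rw [cliffordize_tmul]
    simp only [spinCoact, horCoact, prodCoact, LinearMap.comp_apply, TensorProduct.map_tmul,
      Y.covariant, hϑ, AlgHom.toLinearMap_apply]
    -- Both sides are linear in each of the three coaction values. On pure tensors with `A`-legs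
    -- `a`, `c`, `e` they differ only by `a (c e) = (a c) e`.
    generalize P.F b = t
    generalize X.coactExt ϑ = u
    generalize Y.ϰ ξ = v
    induction t with
    | zero => simp
    | add x y hx hy => simp only [map_add, TensorProduct.add_tmul, LinearMap.add_apply, hx, hy]
    | tmul q a =>
      induction u with
      | zero => simp
      | add x y hx hy => simp only [map_add, TensorProduct.tmul_add, LinearMap.add_apply, hx, hy]
      | tmul η c =>
        induction v with
        | zero => simp
        | add x y hx hy => simp only [map_add, TensorProduct.tmul_add, hx, hy]
        | tmul ζ e => simp [cliffordizeCoact, mul_assoc]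

theorem spinCoact_cliffordOp (Y : SpinorSpace G S) {T : B →ₗ[ℂ] Hor X B} (hT : IsCovariant P T)
    (ψ : B ⊗[ℂ] S) :
    spinCoact P Y (cliffordOp Y T ψ) = (cliffordOp Y T).rTensor A (spinCoact P Y ψ) := by
  induction ψ with
  | zero => simp
  | add x y hx hy => simp only [map_add, hx, hy]
  | tmul b ξ =>
    rw [cliffordOp_tmul, spinCoact_cliffordize, hT]
    simp only [spinCoact, prodCoact, LinearMap.comp_apply, TensorProduct.map_tmul,
      AlgHom.toLinearMap_apply]
    generalize P.F b = t
    generalize Y.ϰ ξ = v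
    induction t with
    | zero => simp
    | add x y hx hy => simp only [map_add, TensorProduct.add_tmul, LinearMap.add_apply, hx, hy]
    | tmul q a =>
      induction v with
      | zero => simp
      | add x y hx hy => simp only [map_add, TensorProduct.tmul_add, hx, hy]
      | tmul ζ e => simp [cliffordizeCoact]

theorem cliffordOp_mem_spinorBundle (Y : SpinorSpace G S) {T : B →ₗ[ℂ] Hor X B}
    (hT : IsCovariant P T) {ψ : B ⊗[ℂ] S} (hψ : ψ ∈ spinorBundle P Y) :
    cliffordOp Y T ψ ∈ spinorBundle P Y := by
  have h : spinCoact P Y ψ = ψ ⊗ₜ[ℂ] 1 := hψ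
  change spinCoact P Y (cliffordOp Y T ψ) = cliffordOp Y T ψ ⊗ₜ[ℂ] 1
  rw [spinCoact_cliffordOp Y hT, h, LinearMap.rTensor_tmul]

theorem dirac_mem_spinorBundle (Φ : FrameStructure P X) (Y : SpinorSpace G S) {ψ : B ⊗[ℂ] S}
    (hψ : ψ ∈ spinorBundle P Y) : dirac Φ Y ψ ∈ spinorBundle P Y := by
  rw [dirac_eq_cliffordOp]
  exact Submodule.smul_mem _ _ (cliffordOp_mem_spinorBundle Y Φ.isCovariant_nablaBase hψ)

theorem curvatureTerm_mem_spinorBundle (Φ : FrameStructure P X) (Y : SpinorSpace G S)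
    {ψ : B ⊗[ℂ] S} (hψ : ψ ∈ spinorBundle P Y) : curvatureTerm Φ Y ψ ∈ spinorBundle P Y :=
  Submodule.neg_mem _ (cliffordOp_mem_spinorBundle Y Φ.isCovariant_nablaSq hψ)

/-- Writing the Laplacian as `D² - R̂` spares a direct check of how the second derivatives and the
`g_ij` transform. -/
theorem spinLaplacian_mem_spinorBundle (Φ : FrameStructure P X) (Y : SpinorSpace G S)
    {ψ : B ⊗[ℂ] S} (hψ : ψ ∈ spinorBundle P Y) : spinLaplacian Φ Y ψ ∈ spinorBundle P Y := by
  rw [← add_sub_cancel_right (spinLaplacian Φ Y ψ) (curvatureTerm Φ Y ψ), ← dirac_dirac]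
  exact Submodule.sub_mem _
    (dirac_mem_spinorBundle Φ Y (dirac_mem_spinorBundle Φ Y hψ))
    (curvatureTerm_mem_spinorBundle Φ Y hψ)

end Dirac

end QuantumSpin

end

theorem mainTheorem1 {A B Q S : Type*}
    [Ring A] [HopfAlgebra ℂ A] [StarRing A] [StarModule ℂ A]
    [Ring B] [Algebra ℂ B] [StarRing B] [StarModule ℂ B]
    [Ring Q] [Algebra ℂ Q] [StarRing Q] [StarModule ℂ Q]
    [NormedAddCommGroup S] [InnerProductSpace ℂ S] [FiniteDimensional ℂ S]
    (hA : QuantumSpin.IsCompactMatrixQuantumGroup A) {d : ℕ}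
    (P : QuantumSpin.PrincipalBundle A B) (X : QuantumSpin.AbstractForms A d)
    (Φ : QuantumSpin.FrameStructure P X) (G : QuantumSpin.QuantumMetric X Q)
    (Y : QuantumSpin.SpinorSpace G S) :
    (∀ ψ ∈ QuantumSpin.spinorBundle P Y,
      QuantumSpin.dirac Φ Y ψ ∈ QuantumSpin.spinorBundle P Y ∧
      QuantumSpin.spinLaplacian Φ Y ψ ∈ QuantumSpin.spinorBundle P Y ∧
      QuantumSpin.curvatureTerm Φ Y ψ ∈ QuantumSpin.spinorBundle P Y ∧
      QuantumSpin.dirac Φ Y (QuantumSpin.dirac Φ Y ψ) =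
        QuantumSpin.spinLaplacian Φ Y ψ + QuantumSpin.curvatureTerm Φ Y ψ) ∧
    ∀ r : A →ₗ[ℂ] QuantumSpin.Hor X B, Φ.IsCurvature r →
      QuantumSpin.curvatureTerm Φ Y =
        QuantumSpin.cliffordOp Y (QuantumSpin.contract P r) := by
  refine ⟨fun ψ hψ => ⟨QuantumSpin.dirac_mem_spinorBundle Φ Y hψ,
    QuantumSpin.spinLaplacian_mem_spinorBundle Φ Y hψ,
    QuantumSpin.curvatureTerm_mem_spinorBundle Φ Y hψ,
    QuantumSpin.dirac_dirac Φ Y ψ⟩, fun r hr => ?_⟩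
  ext b ξ
  -- The minus sign in `IsCurvature` cancels the one in `curvatureTerm`.
  simp [QuantumSpin.curvatureTerm, hr b]
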